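/- Let $G$ be a group with an HNN decomposition $G=A\ast_C=\langle A,t : tCt^{-1}=D\rangle$; that is, $A$ is a subgroup of $G$, $C$ and $D$ are subgroups of $A$, $t\in G$, $tCt^{-1}=D$, and $G$ is (via the canonical map) the HNN extension with base $A$, associated subgroups $C,D$ (identified by $c\mapsto tct^{-1}$) and stable letter $t$. Let $N$ be a normal subgroup of $G$. (1) If $N$ is finitely generated and $N\not\subseteq C$, then $NC$ is of finite index in $G$, and if moreover $N\cap C$ is finitely generated, then $N\cap A$ is finitely generated. (2) Conversely, if $NC$ is of finite index in $G$, then $N\not\subseteq C$, and if moreover $N\cap A$ is finitely generated, then $N$ is finitely generated. (3) If $NC$ is of finite index in $G$, then $G/N$ is finite if and only if $C/(N\cap C)$ is finite. -/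

import Mathlib

/-- `G = ⟨A, t : t C t⁻¹ = D⟩` is an (internal) HNN decomposition of the group `G` with base
subgroup `A`, associated subgroups `C, D ≤ A` and stable letter `t`: conjugation by `t` restricts
to an isomorphism `φ : C ≃* D`, and the canonical homomorphism from the abstract HNN extension
of `A` along `φ` to `G`, which is the inclusion on `A` and sends the stable letter to `t`,
is bijective. (`C.subgroupOf A` is `C` regarded as a subgroup of the group `A`.) -/
def IsHNNDecomposition {G : Type*} [Group G] (A C D : Subgroup G) (t : G) : Prop :=
  C ≤ A ∧ D ≤ A ∧
    ∃ (φ : C.subgroupOf A ≃* D.subgroupOf A)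
      (h : ∀ c : C.subgroupOf A, t * A.subtype (c : A) = A.subtype (φ c : A) * t),
      Function.Bijective (HNNExtension.lift (φ := φ) A.subtype t h)

/-!
The proof replaces the action of `G` on the Bass–Serre tree by one algebraic object. By the
universal property of the HNN extension there is a crossed homomorphism `δ : G → ℤ[G ⧸ C]` which
vanishes on `A` and maps `t⁻¹` to the coset `C`: the cosets of `C` are the edges of the tree, and
`δ g` is the signed path from the base vertex `A` to its translate by `g`. Neither normal forms nor
the fact that the graph is a tree are needed.

*Finite index.* Let `N` be finitely generated. A crossed homomorphism to `ℤ[G ⧸ NC]` with the same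
normalization is on `N` a `G`-equivariant homomorphism. If it does not vanish there, the union of
the supports of its values on `N`, which is finite and `G`-invariant, is all of `G ⧸ NC`
(`finiteIndex_of_crossedHom_ne_zero`). If it does, its augmentation is a homomorphism `G → ℤ`
vanishing on `N` and `A` and mapping `t⁻¹` to `1`. Far out along the axis of `t`, no edge is in the
support of any `δ n` with `n ∈ N`, and this forces all the edges `n C` onto a segment of the axis.
They have height `0`, as has only one edge of the axis, and so `N ≤ C` (`le_of_height`).

*Generation of `N ∩ A`.* This is the argument that in the exact sequence
`0 → ℤ[G ⧸ C] → ℤ[G ⧸ A] → ℤ → 0` of `ℤ[N]`-modules, finite presentation of the outer terms implies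
that of the middle one, carried out with elements. The boundary map, projected to
`ℤ[N ⧸ (N ∩ A)]`, lifts along `ℤ[N ⧸ L] → ℤ[N ⧸ (N ∩ A)]` for a finitely generated `L ≤ N ∩ A`
(`exists_equivariant_lift`) so that the boundary of `δ n` is `n L - L` for `n ∈ N`. For `n ∈ N ∩ A`
the path `δ n` is `0`, and therefore `n ∈ L` (`inf_base_fg`).

*Generation of `N`.* If `NC` has finite index, finitely many elements of `N` together with finitely
many conjugates of `N ∩ A` generate a subgroup `N₀` such that `N₀ R A` is closed under right
multiplication by the generators of `G`, for a finite set `R` (`fg_of_finiteIndex`). That `N` is not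
contained in `C` follows from the homomorphism to `ℤ`, which vanishes on `C`; and the statement on
quotients is a computation of indices.
-/

/-! ### Crossed homomorphisms and permutation modules -/

/-- A crossed homomorphism (1-cocycle) from `G` to the underlying module of the representation `ρ`;
in terms of free differential calculus, a Fox derivation. -/
def IsCrossedHom {G V : Type*} [Group G] [AddCommGroup V] (ρ : Representation ℤ G V)
    (δ : G → V) : Prop :=
  ∀ g h, δ (g * h) = δ g + ρ g (δ h)

namespace IsCrossedHom

variable {G V : Type*} [Group G] [AddCommGroup V] {ρ : Representation ℤ G V} {δ : G → V}

theorem map_one (hδ : IsCrossedHom ρ δ) : δ 1 = 0 := by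
  have h := hδ 1 1
  simpa using h

theorem map_inv (hδ : IsCrossedHom ρ δ) (g : G) : δ g⁻¹ = -ρ g⁻¹ (δ g) := by
  have h := hδ g⁻¹ g
  rw [inv_mul_cancel, hδ.map_one] at h
  exact eq_neg_of_add_eq_zero_left h.symm

theorem map_pow (hδ : IsCrossedHom ρ δ) (g : G) (n : ℕ) :
    δ (g ^ n) = ∑ i ∈ Finset.range n, ρ (g ^ i) (δ g) := by
  induction n with
  | zero => simpa using hδ.map_one
  | succ n ih => rw [pow_succ, hδ, ih, Finset.sum_range_succ]

end IsCrossedHom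

/-- The integral permutation representation `ℤ[X]` of a group `G` acting on `X`. -/
noncomputable def permRep (G X : Type*) [Group G] [MulAction G X] :
    Representation ℤ G (X →₀ ℤ) where
  toFun g := Finsupp.lmapDomain ℤ ℤ (g • ·)
  map_one' := by ext; simp
  map_mul' g h := by ext; simp [mul_smul]

section permRep

variable {G X : Type*} [Group G] [MulAction G X]

@[simp]
theorem permRep_single (g : G) (x : X) (k : ℤ) :
    permRep G X g (Finsupp.single x k) = Finsupp.single (g • x) k := by
  simp [permRep]

@[simp]
theorem permRep_apply (g : G) (f : X →₀ ℤ) (x : X) : permRep G X g f x = f (g⁻¹ • x) := by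
  conv_lhs => rw [← smul_inv_smul g x]
  exact Finsupp.mapDomain_apply (MulAction.injective g) f _

theorem mapDomain_permRep {Y : Type*} [MulAction G Y] {p : X → Y} {g : G}
    (hp : ∀ x, p (g • x) = g • p x) (f : X →₀ ℤ) :
    Finsupp.mapDomain p (permRep G X g f) = permRep G Y g (Finsupp.mapDomain p f) := by
  change Finsupp.mapDomain p (Finsupp.mapDomain _ f) = Finsupp.mapDomain _ (Finsupp.mapDomain p f)
  rw [← Finsupp.mapDomain_comp, ← Finsupp.mapDomain_comp]
  congr 1
  funext x
  exact hp x

/-- The values of a crossed homomorphism to `ℤ[X]` on a finitely generated subgroup `N` are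
supported over a finite set of `N`-orbits, the orbits being recorded by an `N`-invariant map. -/
theorem IsCrossedHom.exists_finite_support {Y : Type*} {δ : G → X →₀ ℤ}
    (hδ : IsCrossedHom (permRep G X) δ) {N : Subgroup G} (hN : N.FG) (p : X → Y)
    (hp : ∀ n ∈ N, ∀ x, p (n • x) = p x) :
    ∃ F : Set Y, F.Finite ∧ ∀ n ∈ N, ∀ x, δ n x ≠ 0 → p x ∈ F := by
  obtain ⟨S, rfl, hS⟩ := (Subgroup.fg_iff N).1 hN
  refine ⟨⋃ s ∈ S, p '' (δ s).support, hS.biUnion fun s _ => (Finset.finite_toSet _).image p, ?_⟩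
  intro n hn
  induction hn using Subgroup.closure_induction with
  | mem s hs =>
    intro x hx
    exact Set.mem_biUnion hs ⟨x, by simpa using hx, rfl⟩
  | one => simp [hδ.map_one]
  | mul g h hg hh ihg ihh =>
    intro x hx
    rw [hδ, Finsupp.add_apply, permRep_apply] at hx
    by_cases h0 : δ g x = 0
    · rw [h0, zero_add] at hx
      simpa [hp _ (inv_mem hg)] using ihh _ hx
    · exact ihg x h0
  | inv g hg ih =>
    intro x hx
    rw [hδ.map_inv, Finsupp.neg_apply, permRep_apply, inv_inv] at hx
    simpa [hp _ hg] using ih _ (neg_ne_zero.1 hx)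

/-- Composing a crossed homomorphism to `ℤ[X]` with the augmentation gives a homomorphism to `ℤ`. -/
theorem IsCrossedHom.exists_augmentation {δ : G → X →₀ ℤ} (hδ : IsCrossedHom (permRep G X) δ) :
    ∃ τ : G →* Multiplicative ℤ, ∀ g,
      (τ g).toAdd = Finsupp.linearCombination ℤ (fun _ : X => (1 : ℤ)) (δ g) := by
  refine ⟨MonoidHom.mk' (fun g => Multiplicative.ofAdd
    (Finsupp.linearCombination ℤ (fun _ : X => (1 : ℤ)) (δ g))) fun g h => ?_, fun g => rfl⟩
  have h1 : (Finsupp.linearCombination ℤ (fun _ : X => (1 : ℤ))) ∘ₗ permRep G X g =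
      Finsupp.linearCombination ℤ (fun _ : X => (1 : ℤ)) := by
    ext; simp
  rw [hδ, _root_.map_add, ofAdd_add, ← LinearMap.comp_apply, h1]

end permRep

/-! ### The universal property of an HNN decomposition -/

/-- The affine permutation `v ↦ ρ g v + w` of a representation. -/
def affinePerm {G V : Type*} [Group G] [AddCommGroup V] (ρ : Representation ℤ G V) (g : G) (w : V) :
    Equiv.Perm V where
  toFun v := ρ g v + w
  invFun v := ρ g⁻¹ (v - w)
  left_inv v := by simp
  right_inv v := by simp

theorem affinePerm_mul {G V : Type*} [Group G] [AddCommGroup V] (ρ : Representation ℤ G V)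
    (g h : G) (w w' : V) :
    affinePerm ρ g w * affinePerm ρ h w' = affinePerm ρ (g * h) (ρ g w' + w) := by
  ext v
  simp [affinePerm, add_assoc]

namespace IsHNNDecomposition

variable {G : Type*} [Group G] {A C D : Subgroup G} {t : G}

theorem conj_mem (hG : IsHNNDecomposition A C D t) {c : G} (hc : c ∈ C) : t * c * t⁻¹ ∈ A := by
  obtain ⟨hCA, hDA, φ, h, hb⟩ := hG
  have h1 := h ⟨⟨c, hCA hc⟩, hc⟩
  simp only [Subgroup.subtype_apply] at h1
  rw [h1, mul_inv_cancel_right]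
  exact (φ _ : A).2

/-- Induction along right multiplication by elements of `A` and by `t⁻¹`, `t`. -/
theorem induction_right (hG : IsHNNDecomposition A C D t) {P : G → Prop} (one : P 1)
    (base : ∀ g, ∀ a ∈ A, P g → P (g * a)) (inv_stable : ∀ g, P g → P (g * t⁻¹))
    (stable : ∀ g, P g → P (g * t)) (g : G) : P g := by
  obtain ⟨hCA, hDA, φ, h, hb⟩ := hG
  have hcl : g ∈ Subgroup.closure ((A : Set G) ∪ {t}) := by
    obtain ⟨x, rfl⟩ := hb.2 g
    induction x using HNNExtension.induction_on with
    | of a =>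
      rw [HNNExtension.lift_of]
      exact Subgroup.subset_closure (Or.inl a.2)
    | t =>
      rw [HNNExtension.lift_t]
      exact Subgroup.subset_closure (Or.inr rfl)
    | mul x y hx hy =>
      rw [map_mul]
      exact mul_mem hx hy
    | inv x hx =>
      rw [map_inv]
      exact inv_mem hx
  induction hcl using Subgroup.closure_induction_right with
  | one => exact one
  | mul_right x hx y hy ih =>
    rcases hy with hy | rfl
    · exact base x y hy ih
    · exact stable x ih
  | mul_inv_cancel x hx y hy ih =>
    rcases hy with hy | rfl
    · exact base x _ (inv_mem hy) ih
    · exact inv_stable x ih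

/-- A crossed homomorphism vanishing on `A` can take at `t⁻¹` any value fixed by `C`: it amounts to
a homomorphism from `G` to the affine group of the representation lying over `ρ`. -/
theorem exists_crossedHom (hG : IsHNNDecomposition A C D t) {V : Type*} [AddCommGroup V]
    (ρ : Representation ℤ G V) (b : V) (hb : ∀ c ∈ C, ρ c b = b) :
    ∃ δ : G → V, IsCrossedHom ρ δ ∧ (∀ a ∈ A, δ a = 0) ∧ δ t⁻¹ = b := by
  obtain ⟨hCA, hDA, φ, h, hbij⟩ := hG
  set L := HNNExtension.lift (φ := φ) A.subtype t h with hL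
  let f : A →* Equiv.Perm V := MonoidHom.mk' (fun a => affinePerm ρ (a : G) 0) fun a a' => by
    rw [affinePerm_mul]; simp
  -- The relation `δ t⁻¹ = b` forces `δ t = -ρ t b`.
  let θ := HNNExtension.lift (φ := φ) f (affinePerm ρ t (-ρ t b)) fun c => by
    change affinePerm ρ t (-ρ t b) * affinePerm ρ _ 0 =
      affinePerm ρ _ 0 * affinePerm ρ t (-ρ t b)
    have hc := h c
    simp only [Subgroup.subtype_apply] at hc
    have hfix : ρ (φ c : A) (ρ t b) = ρ t b := by
      rw [← Module.End.mul_apply, ← map_mul, ← hc, map_mul, Module.End.mul_apply,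
        hb _ (Subgroup.mem_subgroupOf.1 c.2)]
    rw [affinePerm_mul, affinePerm_mul, hc, map_zero, zero_add, add_zero, map_neg, hfix]
  have hθ : ∀ x, ∃ w, θ x = affinePerm ρ (L x) w := by
    intro x
    induction x using HNNExtension.induction_on with
    | of a => exact ⟨0, by simp [θ, hL, HNNExtension.lift_of, f]⟩
    | t => exact ⟨-ρ t b, by simp [θ, hL, HNNExtension.lift_t]⟩
    | mul x y hx hy =>
      obtain ⟨w, hw⟩ := hx
      obtain ⟨w', hw'⟩ := hy
      exact ⟨_, by rw [map_mul, map_mul, hw, hw', affinePerm_mul]⟩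
    | inv x hx =>
      obtain ⟨w, hw⟩ := hx
      refine ⟨-ρ (L x)⁻¹ w, ?_⟩
      rw [map_inv, map_inv, inv_eq_iff_mul_eq_one, hw, affinePerm_mul]
      ext v
      simp [affinePerm]
  obtain ⟨e, he⟩ : ∃ e : G ≃* HNNExtension A _ _ φ, ∀ g, L (e g) = g :=
    ⟨(MulEquiv.ofBijective L hbij).symm, fun g => (MulEquiv.ofBijective L hbij).apply_symm_apply g⟩
  have heL : ∀ x, e (L x) = x := fun x => hbij.1 (he _)
  have hδ : IsCrossedHom ρ fun g => θ (e g) 0 := by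
    intro g g'
    obtain ⟨w, hw⟩ := hθ (e g)
    simp only [map_mul, Equiv.Perm.mul_apply, hw, he]
    simp [affinePerm, add_comm]
  have ht : θ (e t) 0 = -ρ t b := by
    have : e t = HNNExtension.t := by
      rw [← heL HNNExtension.t, hL, HNNExtension.lift_t]
    simp [this, θ, affinePerm]
  refine ⟨_, hδ, fun a ha => ?_, ?_⟩
  · have : e a = HNNExtension.of ⟨a, ha⟩ := by
      rw [← heL (HNNExtension.of _), hL, HNNExtension.lift_of]; rfl
    simp [this, θ, f, affinePerm]
  · rw [hδ.map_inv, ht]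
    simp

/-- For `C ≤ H` there is a crossed homomorphism to `ℤ[G ⧸ H]` which vanishes on `A` and maps `t⁻¹`
to the coset of `H`. For `H = C` its value at `g` is the signed sum of the edges on the path from
the base vertex to its translate by `g` in the Bass–Serre tree, whose edges are the cosets of
`C`. -/
theorem exists_crossedHom_coset (hG : IsHNNDecomposition A C D t) {H : Subgroup G} (hH : C ≤ H) :
    ∃ δ : G → G ⧸ H →₀ ℤ, IsCrossedHom (permRep G (G ⧸ H)) δ ∧ (∀ a ∈ A, δ a = 0) ∧
      δ t⁻¹ = Finsupp.single ((1 : G) : G ⧸ H) 1 := by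
  refine hG.exists_crossedHom _ _ fun c hc => ?_
  rw [permRep_single, MulAction.Quotient.smul_coe, smul_eq_mul, mul_one]
  congr 1
  exact QuotientGroup.eq.2 (by simpa using hH hc)

end IsHNNDecomposition

namespace IsHNNDecomposition

variable {G : Type*} [Group G] {A C D : Subgroup G} {t : G}

/-! ### Finite generation forces finite index -/

/-- Since `N` acts trivially on `G ⧸ NC`, a crossed homomorphism `δ` to `ℤ[G ⧸ NC]` restricts to a
homomorphism on `N` which is equivariant for conjugation by `G`. If `N` is finitely generated, the
union of the supports of its values on `N` is therefore both finite and `G`-invariant; if it is not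
empty, it is the whole transitive `G`-set `G ⧸ NC`. -/
theorem finiteIndex_of_crossedHom_ne_zero {N : Subgroup G} [N.Normal] (hN : N.FG)
    {δ : G → G ⧸ (N ⊔ C) →₀ ℤ} (hδ : IsCrossedHom (permRep G (G ⧸ (N ⊔ C))) δ)
    {n₀ : G} (hn₀ : n₀ ∈ N) (h0 : δ n₀ ≠ 0) : (N ⊔ C).FiniteIndex := by
  have htriv : ∀ n ∈ N, ∀ x : G ⧸ (N ⊔ C), n • x = x := by
    intro n hn x
    induction x using QuotientGroup.induction_on with | H g =>
    rw [MulAction.Quotient.smul_coe, smul_eq_mul, eq_comm, QuotientGroup.eq, ← mul_assoc]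
    exact Subgroup.mem_sup_left (Subgroup.Normal.conj_mem' inferInstance n hn g)
  obtain ⟨F, hF, hFN⟩ := hδ.exists_finite_support hN id htriv
  obtain ⟨x₀, hx₀⟩ := Finsupp.ne_iff.1 h0
  have hall : ∀ x, x ∈ F := by
    intro x
    obtain ⟨g, rfl⟩ := MulAction.exists_smul_eq G x₀ x
    have hmem : g * n₀ * g⁻¹ ∈ N := Subgroup.Normal.conj_mem inferInstance n₀ hn₀ g
    refine hFN _ hmem (g • x₀) ?_
    have hconj : δ (g * n₀ * g⁻¹) =
        δ g + permRep G _ g (δ n₀) - permRep G _ (g * n₀ * g⁻¹) (δ g) := by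
      rw [hδ, hδ, hδ.map_inv, map_neg, ← Module.End.mul_apply, ← map_mul, sub_eq_add_neg]
    rw [hconj, Finsupp.sub_apply, Finsupp.add_apply, permRep_apply, permRep_apply,
      htriv _ (inv_mem hmem), inv_smul_smul, add_sub_cancel_left]
    exact hx₀
  have : Finite (G ⧸ (N ⊔ C)) := Set.finite_univ_iff.1 (hF.subset fun x _ => hall x)
  exact Subgroup.finiteIndex_of_finite_quotient

/-- If a homomorphism `τ` to `ℤ` vanishes on `C` and on the finitely generated normal subgroup `N`
and maps `t⁻¹` to `1`, then `N ≤ C`. The paths from the base vertex to its `N`-translates use edges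
of finitely many `N`-orbits only, so that for large `k` they avoid the edges `t ^ k C` and
`t ^ (-k) C`. Moving the base vertex to `t ^ k` and to `t ^ (-k)`, this says that the `N`-orbit of
either of these two vertices lies on one side of the edge `C`. Hence the path joining them crosses
all the translates of `C` under `N`; but only one edge of that path has the same height as `C`. -/
theorem le_of_height (hG : IsHNNDecomposition A C D t) {N : Subgroup G} [N.Normal] (hN : N.FG)
    (τ : G →* Multiplicative ℤ) (hτC : C ≤ τ.ker) (hτN : N ≤ τ.ker)
    (hτt : τ t⁻¹ = Multiplicative.ofAdd 1) : N ≤ C := by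
  classical
  obtain ⟨δ, hδ, -, hδt⟩ := hG.exists_crossedHom_coset (le_refl C)
  have hker : N ⊔ C ≤ τ.ker := sup_le hτN hτC
  have hτz : ∀ k : ℤ, (τ (t⁻¹ ^ k)).toAdd = k := fun k => by
    rw [map_zpow, hτt, toAdd_zpow, toAdd_ofAdd, smul_eq_mul, mul_one]
  obtain ⟨F, hF, hFN⟩ := hδ.exists_finite_support hN
    (Subgroup.quotientMapOfLE (le_sup_right : C ≤ N ⊔ C)) (by
      intro n hn x
      induction x using QuotientGroup.induction_on with | H g =>
      rw [MulAction.Quotient.smul_coe, smul_eq_mul, Subgroup.quotientMapOfLE_apply_mk,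
        Subgroup.quotientMapOfLE_apply_mk, eq_comm, QuotientGroup.eq, ← mul_assoc]
      exact Subgroup.mem_sup_left (Subgroup.Normal.conj_mem' inferInstance n hn g))
  have hinj : Function.Injective fun k : ℤ => ((t⁻¹ ^ k : G) : G ⧸ (N ⊔ C)) := by
    intro k l hkl
    have h1 := hker (QuotientGroup.eq.1 hkl)
    rw [MonoidHom.mem_ker, map_mul, map_inv, inv_mul_eq_one] at h1
    rw [← hτz k, h1, hτz]
  have hfin := hF.preimage (hinj.injOn)
  obtain ⟨k, hk0, hkp, hkn⟩ : ∃ k : ℕ, 0 < k ∧ ((t⁻¹ ^ (k : ℤ) : G) : G ⧸ (N ⊔ C)) ∉ F ∧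
      ((t⁻¹ ^ (-k : ℤ) : G) : G ⧸ (N ⊔ C)) ∉ F := by
    obtain ⟨u, hu⟩ := hfin.bddAbove
    obtain ⟨l, hl⟩ := hfin.bddBelow
    refine ⟨u.natAbs + l.natAbs + 1, by omega, fun h => ?_, fun h => ?_⟩
    · have h1 : ((u.natAbs + l.natAbs + 1 : ℕ) : ℤ) ≤ u := hu h
      omega
    · have h1 : l ≤ -((u.natAbs + l.natAbs + 1 : ℕ) : ℤ) := hl h
      omega
  have hsep : ∀ n ∈ N, ∀ y : G, ((y⁻¹ : G) : G ⧸ (N ⊔ C)) ∉ F →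
      δ y ((n⁻¹ : G) : G ⧸ C) = δ y ((1 : G) : G ⧸ C) - δ n ((1 : G) : G ⧸ C) := by
    intro n hn y hy
    have h1 := hδ n y
    have h2 := hδ y (y⁻¹ * n * y)
    have h3 : δ (y⁻¹ * n * y) ((y⁻¹ : G) : G ⧸ C) = 0 := by
      by_contra h
      exact hy (hFN _ (Subgroup.Normal.conj_mem' inferInstance n hn y) _ h)
    rw [show y * (y⁻¹ * n * y) = n * y by group, h1] at h2
    have h4 := DFunLike.congr_fun h2 ((1 : G) : G ⧸ C)
    simp only [Finsupp.add_apply, permRep_apply, MulAction.Quotient.smul_coe, smul_eq_mul,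
      mul_one, h3] at h4
    linarith
  -- The edges `t⁻¹ ^ j C`, `-k ≤ j < k`, on the path from `t ^ k` to `t ^ (-k)`.
  have hpath : ∀ x, δ (t⁻¹ ^ k) x - δ (t⁻¹ ^ (-k : ℤ)) x =
      ∑ i ∈ Finset.range (2 * k), if ((t⁻¹ ^ (-k + i : ℤ) : G) : G ⧸ C) = x then 1 else 0 := by
    intro x
    have h1 : t⁻¹ ^ k = t⁻¹ ^ (-k : ℤ) * t⁻¹ ^ (2 * k) := by
      rw [← zpow_natCast, ← zpow_natCast, ← zpow_add]
      congr 1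
      push_cast
      ring
    conv_lhs => rw [h1, hδ, hδ.map_pow, hδt]
    simp only [map_sum, Finsupp.add_apply, add_sub_cancel_left, permRep_single,
      Finsupp.finsetSum_apply,
      Finsupp.single_apply, MulAction.Quotient.smul_coe, smul_eq_mul, mul_one]
    refine Finset.sum_congr rfl fun i _ => ?_
    rw [zpow_add, zpow_natCast]
  intro n hn
  have hp : δ (t⁻¹ ^ k) ((n⁻¹ : G) : G ⧸ C) - δ (t⁻¹ ^ (-k : ℤ)) ((n⁻¹ : G) : G ⧸ C) =
      δ (t⁻¹ ^ k) ((1 : G) : G ⧸ C) - δ (t⁻¹ ^ (-k : ℤ)) ((1 : G) : G ⧸ C) := by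
    rw [hsep n hn, hsep n hn]
    · ring
    · simpa using hkp
    · simpa using hkn
  rw [hpath, hpath] at hp
  have hpos : 0 < ∑ i ∈ Finset.range (2 * k),
      if ((t⁻¹ ^ (-k + i : ℤ) : G) : G ⧸ C) = ((1 : G) : G ⧸ C) then (1 : ℤ) else 0 := by
    refine Finset.sum_pos' (fun i _ => by split_ifs <;> simp) ⟨k, by simp; omega, by simp⟩
  rw [← hp] at hpos
  obtain ⟨i, -, hi⟩ := Finset.exists_ne_zero_of_sum_ne_zero hpos.ne'
  have hi : ((t⁻¹ ^ (-k + i : ℤ) : G) : G ⧸ C) = (n⁻¹ : G) := by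
    by_contra h
    exact hi (if_neg h)
  have hmem := QuotientGroup.eq.1 hi
  have h0 : (-k + i : ℤ) = 0 := by
    have h1 := hτC hmem
    rw [MonoidHom.mem_ker, map_mul, map_inv, (hτN (inv_mem hn) : τ n⁻¹ = 1), mul_one,
      inv_eq_one] at h1
    rw [← hτz (-k + i), h1]
    rfl
  rw [h0] at hmem
  simpa using hmem

/-- The augmentation of the crossed homomorphism to `ℤ[G ⧸ H]`: up to sign, it is the homomorphism
counting the exponent of the stable letter. -/
theorem exists_height {H : Subgroup G} {δ : G → G ⧸ H →₀ ℤ}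
    (hδ : IsCrossedHom (permRep G (G ⧸ H)) δ) (hA : ∀ a ∈ A, δ a = 0)
    (ht : δ t⁻¹ = Finsupp.single ((1 : G) : G ⧸ H) 1) :
    ∃ τ : G →* Multiplicative ℤ, A ≤ τ.ker ∧ τ t⁻¹ = Multiplicative.ofAdd 1 ∧
      ∀ g, τ g ≠ 1 → δ g ≠ 0 := by
  obtain ⟨τ, hτ⟩ := hδ.exists_augmentation
  have h0 : ∀ g, δ g = 0 → τ g = 1 := fun g hg =>
    Multiplicative.toAdd.injective (by rw [hτ, hg, map_zero, toAdd_one])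
  refine ⟨τ, fun a ha => h0 a (hA a ha), Multiplicative.toAdd.injective ?_,
    fun g hg hδg => hg (h0 g hδg)⟩
  rw [hτ, ht]
  simp

theorem finiteIndex_of_fg (hG : IsHNNDecomposition A C D t) {N : Subgroup G} [N.Normal]
    (hN : N.FG) (hNC : ¬ N ≤ C) : (N ⊔ C).FiniteIndex := by
  obtain ⟨δ, hδ, hδA, hδt⟩ := hG.exists_crossedHom_coset (le_sup_right : C ≤ N ⊔ C)
  obtain ⟨τ, hτA, hτt, hτ⟩ := exists_height hδ hδA hδt
  obtain ⟨n, hn, hn1⟩ : ∃ n ∈ N, τ n ≠ 1 := by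
    by_contra! h
    exact hNC (hG.le_of_height hN τ (hG.1.trans hτA) h hτt)
  exact finiteIndex_of_crossedHom_ne_zero hN hδ hn (hτ n hn1)

theorem not_le_of_finiteIndex (hG : IsHNNDecomposition A C D t) {N : Subgroup G}
    (h : (N ⊔ C).FiniteIndex) : ¬ N ≤ C := by
  intro hNC
  rw [sup_eq_right.2 hNC] at h
  obtain ⟨δ, hδ, hδA, hδt⟩ := hG.exists_crossedHom_coset (le_refl C)
  obtain ⟨τ, hτA, hτt, -⟩ := exists_height hδ hδA hδt
  obtain ⟨k, hk, -, hmem⟩ := Subgroup.exists_pow_mem_of_index_ne_zero h.index_ne_zero t⁻¹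
  have h1 : τ (t⁻¹ ^ k) = 1 := hτA (hG.1 hmem)
  rw [map_pow, hτt, ← ofAdd_nsmul, ofAdd_eq_one] at h1
  simp at h1
  omega

/-! ### Finite generation of the normal subgroup -/

/-- If `NC` has finite index then, for `y = t` and `y = t⁻¹`, the set `A y` is covered by finitely
many double cosets `(N ∩ A) a y A`. -/
theorem exists_finite_cover (hG : IsHNNDecomposition A C D t) {N : Subgroup G} [N.Normal]
    (h : (N ⊔ C).FiniteIndex) {y : G} (hy : y = t ∨ y = t⁻¹) :
    ∃ T : Set G, T.Finite ∧ ∀ a ∈ A, ∃ m ∈ N ⊓ A, ∃ a' ∈ T, ∃ b ∈ A, a * y = m * a' * y * b := by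
  -- The edge between the vertices `1` and `y` is the coset `z C`, with `z = t` or `z = 1`.
  obtain ⟨z, hzA, hzy⟩ : ∃ z : G, (∀ c ∈ C, z * c * z⁻¹ ∈ A) ∧
      ∀ c ∈ C, y⁻¹ * z * c * z⁻¹ * y ∈ A := by
    rcases hy with rfl | rfl
    · exact ⟨y, fun c hc => hG.conj_mem hc, fun c hc => by simpa using hG.1 hc⟩
    · exact ⟨1, fun c hc => by simpa using hG.1 hc, fun c hc => by simpa using hG.conj_mem hc⟩
  -- Choose one element of `A` for each coset of `NC` which meets `A z`.
  let q : A → G ⧸ (N ⊔ C) := fun a => ((a * z : G) : G ⧸ (N ⊔ C))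
  have : Finite (G ⧸ (N ⊔ C)) := Subgroup.finiteIndex_iff_finite_quotient.1 h
  let s : Set.range q → A := fun x => x.2.choose
  have hs : ∀ x, q (s x) = x := fun x => x.2.choose_spec
  refine ⟨Set.range fun x => (s x : G), Set.finite_range _, fun a ha => ?_⟩
  let a' := s ⟨q ⟨a, ha⟩, _, rfl⟩
  have hq : q a' = q ⟨a, ha⟩ := hs _
  obtain ⟨n, hn, c, hc, hnc⟩ := Subgroup.mem_sup_of_normal_left.1 (QuotientGroup.eq.1 hq)
  have hm : (a' * z : G) * n * (a' * z : G)⁻¹ = a * (z * c * z⁻¹)⁻¹ * (a' : G)⁻¹ := by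
    rw [eq_mul_inv_of_mul_eq hnc]
    group
  refine ⟨(a' * z) * n * (a' * z : G)⁻¹, ⟨Subgroup.Normal.conj_mem inferInstance n hn _, ?_⟩,
    a', ⟨_, rfl⟩, y⁻¹ * z * c * z⁻¹ * y, hzy c hc, ?_⟩
  · rw [hm]
    exact A.mul_mem (A.mul_mem ha (A.inv_mem (hzA c hc))) (A.inv_mem a'.2)
  · rw [hm]
    group

theorem _root_.Subgroup.exists_eq_mul_out_mul (N H : Subgroup G) [N.Normal] (g : G) :
    ∃ n ∈ N, ∃ c ∈ H, g = n * (g : G ⧸ (N ⊔ H)).out * c := by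
  set x := (g : G ⧸ (N ⊔ H)).out
  obtain ⟨n, hn, c, hc, hnc⟩ := Subgroup.mem_sup_of_normal_left.1
    (QuotientGroup.eq.1 (QuotientGroup.out_eq' (g : G ⧸ (N ⊔ H))))
  refine ⟨_, Subgroup.Normal.conj_mem inferInstance n hn x, c, hc, ?_⟩
  have : g = x * (n * c) := by rw [hnc]; exact (mul_inv_cancel_left _ _).symm
  rw [this]
  group

/-- A finitely generated subgroup `N₀ ≤ N` is chosen large enough that `N₀ R A` is closed under
right multiplication by `A` and by `t`, `t⁻¹`, where `R` is a finite set with `N R A = G`. -/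
theorem fg_of_finiteIndex (hG : IsHNNDecomposition A C D t) {N : Subgroup G} [N.Normal]
    (h : (N ⊔ C).FiniteIndex) (hM : (N ⊓ A).FG) : N.FG := by
  obtain ⟨S, hS, hSf⟩ := (Subgroup.fg_iff _).1 hM
  have : Finite (G ⧸ (N ⊔ C)) := Subgroup.finiteIndex_iff_finite_quotient.1 h
  let R : Set G := Set.range (Quotient.out : G ⧸ (N ⊔ C) → G)
  have hR : R.Finite := Set.finite_range _
  have hdec : ∀ g : G, ∃ n : N, ∃ x ∈ R, ∃ a ∈ A, g = n * x * a := by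
    intro g
    obtain ⟨n, hn, c, hc, e⟩ := N.exists_eq_mul_out_mul C g
    exact ⟨⟨n, hn⟩, _, ⟨_, rfl⟩, c, hG.1 hc, e⟩
  -- `ν g` is the component in `N` of a decomposition of `g` according to `G = N R A`.
  choose ν hν using hdec
  have hcoset : ∀ x : G, ∃ n : N, (∃ a ∈ A, x * a ∈ N) → ∃ a ∈ A, (n : G) = x * a := by
    intro x
    by_cases hx : ∃ a ∈ A, x * a ∈ N
    · obtain ⟨a, ha, hxa⟩ := hx
      exact ⟨⟨_, hxa⟩, fun _ => ⟨a, ha, rfl⟩⟩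
    · exact ⟨1, fun h => absurd h hx⟩
  -- `μ x` is an element of `N ∩ x A`, if there is one.
  choose μ hμ using hcoset
  obtain ⟨T, hT, hTt⟩ := hG.exists_finite_cover h (Or.inl rfl)
  obtain ⟨T', hT', hTt'⟩ := hG.exists_finite_cover h (Or.inr rfl)
  let Z : Set G := S ∪ Set.image2 (fun x s => x * s * x⁻¹) R S ∪ {(ν 1 : G)} ∪
    (fun x => (μ x : G)) '' R ∪ Set.image2 (fun x a => (ν (x * a * t) : G)) R T ∪
    Set.image2 (fun x a => (ν (x * a * t⁻¹) : G)) R T'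
  have hZ : Z.Finite := ((((hSf.union (hR.image2 _ hSf)).union (Set.finite_singleton _)).union
    (hR.image _)).union (hR.image2 _ hT)).union (hR.image2 _ hT')
  set N₀ := Subgroup.closure Z
  have hZN : ∀ z ∈ Z, z ∈ N₀ := fun z hz => Subgroup.subset_closure hz
  have hSN : ∀ s ∈ S, s ∈ N ⊓ A := fun s hs => hS ▸ Subgroup.subset_closure hs
  have hN₀N : N₀ ≤ N := by
    refine (Subgroup.closure_le _).2 ?_
    rintro _ (((((hs | ⟨x, -, s, hs, rfl⟩) | rfl) | ⟨x, -, rfl⟩) | ⟨x, -, a, -, rfl⟩) |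
      ⟨x, -, a, -, rfl⟩)
    · exact (hSN _ hs).1
    · exact Subgroup.Normal.conj_mem inferInstance s (hSN s hs).1 x
    all_goals exact (_ : N).2
  have hMN₀ : N ⊓ A ≤ N₀ := by
    rw [← hS, Subgroup.closure_le]
    intro s hs
    exact hZN _ (by simp [Z, hs])
  have hconj : ∀ x ∈ R, ∀ m ∈ N ⊓ A, x * m * x⁻¹ ∈ N₀ := by
    intro x hx
    have : N ⊓ A ≤ N₀.comap (MulAut.conj x).toMonoidHom := by
      rw [← hS, Subgroup.closure_le]
      intro s hs
      exact hZN _ (Or.inl (Or.inl (Or.inl (Or.inl (Or.inr ⟨x, hx, s, hs, rfl⟩)))))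
    exact fun m hm => this hm
  have hcover : ∀ g : G, ∃ n ∈ N₀, ∃ x ∈ R, ∃ a ∈ A, g = n * x * a := by
    have step : ∀ y : G, ∀ U : Set G, (∀ a ∈ A, ∃ m ∈ N ⊓ A, ∃ a' ∈ U, ∃ b ∈ A,
        a * y = m * a' * y * b) → (∀ x ∈ R, ∀ a ∈ U, (ν (x * a * y) : G) ∈ N₀) →
        ∀ g, (∃ n ∈ N₀, ∃ x ∈ R, ∃ a ∈ A, g = n * x * a) →
          ∃ n ∈ N₀, ∃ x ∈ R, ∃ a ∈ A, g * y = n * x * a := by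
      rintro y U hU hνU _ ⟨n, hn, x, hx, a, ha, rfl⟩
      obtain ⟨m, hm, a', ha', b, hb, e⟩ := hU a ha
      obtain ⟨x', hx', a'', ha'', e'⟩ := hν (x * a' * y)
      refine ⟨n * (x * m * x⁻¹) * ν (x * a' * y),
        mul_mem (mul_mem hn (hconj x hx m hm)) (hνU x hx a' ha'), x', hx', a'' * b,
        mul_mem ha'' hb, ?_⟩
      calc n * x * a * y = n * x * (a * y) := by group
        _ = n * (x * m * x⁻¹) * (x * a' * y) * b := by rw [e]; group
        _ = n * (x * m * x⁻¹) * (ν (x * a' * y) * x' * a'') * b := by rw [← e']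
        _ = _ := by group
    refine hG.induction_right ?_ ?_ ?_ ?_
    · obtain ⟨x, hx, a, ha, e⟩ := hν 1
      exact ⟨_, hZN _ (by simp [Z]), x, hx, a, ha, e⟩
    · rintro _ a ha ⟨n, hn, x, hx, b, hb, rfl⟩
      exact ⟨n, hn, x, hx, b * a, mul_mem hb ha, by group⟩
    · exact step _ T' hTt' fun x hx a ha => hZN _ (Or.inr ⟨x, hx, a, ha, rfl⟩)
    · exact step _ T hTt fun x hx a ha => hZN _ (Or.inl (Or.inr ⟨x, hx, a, ha, rfl⟩))
  refine (Subgroup.fg_iff _).2 ⟨Z, le_antisymm hN₀N fun n hn => ?_, hZ⟩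
  obtain ⟨n₀, hn₀, x, hx, a, ha, e⟩ := hcover n
  have hxa : x * a ∈ N := by
    have : x * a = n₀⁻¹ * n := by rw [e]; group
    rw [this]
    exact N.mul_mem (N.inv_mem (hN₀N hn₀)) hn
  obtain ⟨b, hb, e'⟩ := hμ x ⟨a, ha, hxa⟩
  have hμN₀ : (μ x : G) ∈ N₀ := hZN _ (Or.inl (Or.inl (Or.inr ⟨x, hx, rfl⟩)))
  have hba : (μ x : G)⁻¹ * (x * a) ∈ N ⊓ A := by
    refine ⟨N.mul_mem (N.inv_mem (μ x).2) hxa, ?_⟩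
    rw [e', show (x * b)⁻¹ * (x * a) = b⁻¹ * a by group]
    exact A.mul_mem (A.inv_mem hb) ha
  have : n = n₀ * (μ x : G) * ((μ x : G)⁻¹ * (x * a)) := by rw [e]; group
  rw [this]
  exact mul_mem (mul_mem hn₀ hμN₀) (hMN₀ hba)

end IsHNNDecomposition

/-! ### Finite quotients -/

theorem Subgroup.finite_quotient_iff_of_finiteIndex_sup {G : Type*} [Group G] {N C : Subgroup G}
    [N.Normal] (h : (N ⊔ C).FiniteIndex) :
    Finite (G ⧸ N) ↔ Finite (C ⧸ N.subgroupOf C) := by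
  rw [← Subgroup.finiteIndex_iff_finite_quotient, ← Subgroup.finiteIndex_iff_finite_quotient,
    Subgroup.finiteIndex_iff, Subgroup.finiteIndex_iff,
    ← Subgroup.relIndex_mul_index (le_sup_left : N ≤ N ⊔ C), Subgroup.relIndex_sup_left]
  exact ⟨left_ne_zero_of_mul, fun h1 => mul_ne_zero h1 h.index_ne_zero⟩

/-! ### Finite generation of the intersection with the base group -/

section

variable {G : Type*} [Group G]

/-- The kernel of `ℤ[G ⧸ K] → ℤ[G ⧸ M]` is the directed union of the kernels of
`ℤ[G ⧸ K] → ℤ[G ⧸ L]`, where `L ≤ M` is finitely generated over `K`. -/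
theorem Subgroup.exists_fg_mapDomain_eq_zero {K M : Subgroup G} (hKM : K ≤ M) (hK : K.FG)
    {ι : Type*} [Finite ι] (u : ι → G ⧸ K →₀ ℤ)
    (hu : ∀ i, Finsupp.mapDomain (Subgroup.quotientMapOfLE hKM) (u i) = 0) :
    ∃ (L : Subgroup G) (hKL : K ≤ L), L ≤ M ∧ L.FG ∧
      ∀ i, Finsupp.mapDomain (Subgroup.quotientMapOfLE hKL) (u i) = 0 := by
  let W : Set (G ⧸ K) := ⋃ i, (u i).support
  have hW : W.Finite := Set.finite_iUnion fun i => Finset.finite_toSet _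
  let P : Set G := Set.image2 (fun x y => x.out⁻¹ * y.out) W W ∩ M
  have hP : P.Finite := (hW.image2 _ hW).inter_of_left _
  have hKL : K ≤ K ⊔ Subgroup.closure P := le_sup_left
  have hLM : K ⊔ Subgroup.closure P ≤ M :=
    sup_le hKM ((Subgroup.closure_le _).2 Set.inter_subset_right)
  refine ⟨_, hKL, hLM, hK.sup ((Subgroup.fg_iff _).2 ⟨P, rfl, hP⟩), fun i => ?_⟩
  -- Two points of the supports which agree in `G ⧸ M` already agree in `G ⧸ L`.
  have hinj : Set.InjOn (Subgroup.quotientMapOfLE hLM) (Subgroup.quotientMapOfLE hKL '' W) := by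
    rintro _ ⟨x, hx, rfl⟩ _ ⟨y, hy, rfl⟩ hxy
    rw [← QuotientGroup.out_eq' x, ← QuotientGroup.out_eq' y] at hxy ⊢
    simp only [Subgroup.quotientMapOfLE_apply_mk, QuotientGroup.eq] at hxy ⊢
    exact Subgroup.mem_sup_right (Subgroup.subset_closure ⟨⟨x, hx, y, hy, rfl⟩, hxy⟩)
  refine Finsupp.mapDomain_injOn _ hinj ?_ (by simp) ?_
  · classical
    refine (Finset.coe_subset.2 Finsupp.mapDomain_support).trans ?_
    rw [Finset.coe_image]
    exact Set.image_mono (Set.subset_iUnion (fun i => ((u i).support : Set (G ⧸ K))) i)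
  · rw [← Finsupp.mapDomain_comp, Finsupp.mapDomain_zero, ← hu i]
    congr 1
    funext x
    induction x using QuotientGroup.induction_on with | H g => rfl

theorem mapDomain_quotientMapOfLE_permRep {K L : Subgroup G} (hKL : K ≤ L) (g : G)
    (f : G ⧸ K →₀ ℤ) :
    Finsupp.mapDomain (Subgroup.quotientMapOfLE hKL) (permRep G _ g f) =
      permRep G _ g (Finsupp.mapDomain (Subgroup.quotientMapOfLE hKL) f) := by
  refine mapDomain_permRep (fun x => ?_) f
  induction x using QuotientGroup.induction_on with | H h => rfl

/-- If `NC` has finite index and `N ∩ C` is finitely generated, then `ℤ[G ⧸ C]` is a finitely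
presented `ℤ[N]`-module. As `ℤ[G ⧸ M]` is the directed colimit of the `ℤ[G ⧸ K]` over the finitely
generated `K ≤ M`, a map from `ℤ[G ⧸ C]` to it lifts to some `ℤ[G ⧸ K]`. -/
theorem exists_equivariant_lift {N C M : Subgroup G} [N.Normal] (h : (N ⊔ C).FiniteIndex)
    (hNC : (N ⊓ C).FG) (d : (G ⧸ C →₀ ℤ) →ₗ[ℤ] (G ⧸ M →₀ ℤ))
    (hd : ∀ n ∈ N, ∀ f, d (permRep G _ n f) = permRep G _ n (d f)) :
    ∃ (K : Subgroup G) (hKM : K ≤ M) (ψ : (G ⧸ C →₀ ℤ) →ₗ[ℤ] (G ⧸ K →₀ ℤ)), K.FG ∧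
      (∀ n ∈ N, ∀ f, ψ (permRep G _ n f) = permRep G _ n (ψ f)) ∧
      ∀ f, Finsupp.mapDomain (Subgroup.quotientMapOfLE hKM) (ψ f) = d f := by
  obtain ⟨S, hS, hSf⟩ := (Subgroup.fg_iff _).1 hNC
  have : Finite (G ⧸ (N ⊔ C)) := Subgroup.finiteIndex_iff_finite_quotient.1 h
  have : Finite S := hSf
  have hsurj : ∀ q : G ⧸ (N ⊔ C), ∃ u : G ⧸ (⊥ : Subgroup G) →₀ ℤ,
      Finsupp.mapDomain (Subgroup.quotientMapOfLE (bot_le : ⊥ ≤ M)) u =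
        d (Finsupp.single (q.out : G ⧸ C) 1) := fun q =>
    Finsupp.mapDomain_surjective (fun x => by
      induction x using QuotientGroup.induction_on with | H g => exact ⟨(g : G ⧸ ⊥), rfl⟩) _
  choose u hu using hsurj
  -- `q.out * s * q.out⁻¹`, for `s ∈ S`, generate the stabilizer in `N` of the coset `q.out C`.
  obtain ⟨K, hK, hKM, hKfg, hKu⟩ := Subgroup.exists_fg_mapDomain_eq_zero (bot_le : ⊥ ≤ M)
    ((Subgroup.fg_iff _).2 ⟨∅, Subgroup.closure_empty, Set.finite_empty⟩)
    (fun i : (G ⧸ (N ⊔ C)) × S =>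
      permRep G _ (i.1.out * i.2 * i.1.out⁻¹) (u i.1) - u i.1) (by
      rintro ⟨q, s, hs⟩
      have hs' : s ∈ N ⊓ C := hS ▸ Subgroup.subset_closure hs
      have hfix : ((q.out * s * q.out⁻¹ * q.out : G) : G ⧸ C) = q.out :=
        (QuotientGroup.eq.2 (by simpa [mul_assoc] using hs'.2)).symm
      rw [Finsupp.mapDomain_sub, mapDomain_quotientMapOfLE_permRep, hu,
        ← hd _ (Subgroup.Normal.conj_mem inferInstance s hs'.1 _), permRep_single,
        MulAction.Quotient.smul_coe, smul_eq_mul, hfix, sub_self])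
  let v : ∀ q : G ⧸ (N ⊔ C), G ⧸ K →₀ ℤ := fun q =>
    Finsupp.mapDomain (Subgroup.quotientMapOfLE hK) (u q)
  have hvM : ∀ q, Finsupp.mapDomain (Subgroup.quotientMapOfLE hKM) (v q) =
      d (Finsupp.single (q.out : G ⧸ C) 1) := by
    intro q
    rw [← hu q, ← Finsupp.mapDomain_comp]
    congr 1
    funext x
    induction x using QuotientGroup.induction_on with | H g => rfl
  have hvfix : ∀ q, ∀ s ∈ N ⊓ C, permRep G _ (q.out * s * q.out⁻¹) (v q) = v q := by
    intro q s hs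
    rw [← hS] at hs
    induction hs using Subgroup.closure_induction with
    | mem s hs =>
      have h1 := hKu (q, ⟨s, hs⟩)
      rwa [Finsupp.mapDomain_sub, mapDomain_quotientMapOfLE_permRep, sub_eq_zero] at h1
    | one => simp
    | mul x y _ _ hx hy =>
      rw [show q.out * (x * y) * q.out⁻¹ = (q.out * x * q.out⁻¹) * (q.out * y * q.out⁻¹) by group,
        map_mul, Module.End.mul_apply, hy, hx]
    | inv x _ hx =>
      conv_lhs => rw [← hx]
      rw [← Module.End.mul_apply, ← map_mul,
        show (q.out * x⁻¹ * q.out⁻¹) * (q.out * x * q.out⁻¹) = 1 by group, map_one,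
        Module.End.one_apply]
  have hdec : ∀ e : G ⧸ C, ∃ (n : N) (q : G ⧸ (N ⊔ C)), ((n * q.out : G) : G ⧸ C) = e := by
    intro e
    induction e using QuotientGroup.induction_on with | H g =>
    obtain ⟨n, hn, c, hc, e⟩ := N.exists_eq_mul_out_mul C g
    refine ⟨⟨n, hn⟩, (g : G ⧸ (N ⊔ C)), QuotientGroup.eq.2 ?_⟩
    rwa [inv_mul_eq_of_eq_mul e]
  choose ν κ hνκ using hdec
  let ψ₀ : G ⧸ C → G ⧸ K →₀ ℤ := fun e => permRep G _ (ν e : G) (v (κ e))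
  have hψ₀ : ∀ n ∈ N, ∀ q : G ⧸ (N ⊔ C), ψ₀ ((n * q.out : G) : G ⧸ C) = permRep G _ n (v q) := by
    intro n hn q
    set e : G ⧸ C := ((n * q.out : G) : G ⧸ C) with he
    have hclass : ∀ m ∈ N, ∀ q : G ⧸ (N ⊔ C), ((m * q.out : G) : G ⧸ (N ⊔ C)) = q := by
      intro m hm q
      conv_rhs => rw [← QuotientGroup.out_eq' q]
      rw [eq_comm, QuotientGroup.eq, ← mul_assoc]
      exact Subgroup.mem_sup_left (Subgroup.Normal.conj_mem' inferInstance m hm _)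
    have hκ : κ e = q := by
      rw [← hclass _ (ν e).2 (κ e), ← hclass n hn q]
      exact congrArg (Subgroup.quotientMapOfLE (le_sup_right : C ≤ N ⊔ C)) (hνκ e)
    have hmem := hνκ e
    rw [hκ, eq_comm, he, QuotientGroup.eq, ← he] at hmem
    have hs : q.out⁻¹ * (n⁻¹ * ν e) * q.out ∈ N ⊓ C :=
      ⟨Subgroup.Normal.conj_mem' inferInstance _ (N.mul_mem (N.inv_mem hn) (ν e).2) _,
        by simpa [mul_assoc] using hmem⟩
    have hfix := hvfix q _ hs
    rw [show q.out * (q.out⁻¹ * (n⁻¹ * ν e) * q.out) * q.out⁻¹ = n⁻¹ * ν e by group] at hfix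
    change permRep G _ (ν e : G) (v (κ e)) = _
    rw [hκ, ← mul_inv_cancel_left n (ν e : G), map_mul, Module.End.mul_apply, hfix]
  refine ⟨K, hKM, Finsupp.linearCombination ℤ ψ₀, hKfg, fun n hn f => ?_, fun f => ?_⟩
  · induction f using Finsupp.induction_linear with
    | zero => simp
    | add f g hf hg => simp only [map_add, hf, hg]
    | single e k =>
      rw [← hνκ e, permRep_single, Finsupp.linearCombination_single,
        Finsupp.linearCombination_single, MulAction.Quotient.smul_coe, smul_eq_mul, ← mul_assoc,
        hψ₀ _ (N.mul_mem hn (ν e).2), hψ₀ _ (ν e).2, map_smul, map_mul, Module.End.mul_apply]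
  · induction f using Finsupp.induction_linear with
    | zero => simp
    | add f g hf hg => rw [map_add, map_add, Finsupp.mapDomain_add, hf, hg]
    | single e k =>
      rw [← hνκ e, Finsupp.linearCombination_single, hψ₀ _ (ν e).2, Finsupp.mapDomain_smul,
        mapDomain_quotientMapOfLE_permRep, hvM, ← hd _ (ν e).2, permRep_single,
        MulAction.Quotient.smul_coe, smul_eq_mul, ← map_smul, Finsupp.smul_single, smul_eq_mul,
        mul_one]

/-- The `N`-equivariant projection of the set of vertices `G ⧸ A` to the orbit `N ⧸ (N ∩ A)` of the
base vertex, all other vertices being sent to `0`. The orbit is embedded in `G ⧸ (N ∩ A)`, and the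
projection is described as a function on `G`. -/
theorem exists_orbit_projection (N A : Subgroup G) :
    ∃ l : G → (G ⧸ (N ⊓ A) →₀ ℤ), (∀ n ∈ N, ∀ g, l (n * g) = permRep G _ n (l g)) ∧
      (∀ g, ∀ a ∈ A, l (g * a) = l g) ∧ l 1 = Finsupp.single ((1 : G) : G ⧸ (N ⊓ A)) 1 := by
  classical
  let l : G → (G ⧸ (N ⊓ A) →₀ ℤ) := fun g =>
    if h : ∃ n ∈ N, n⁻¹ * g ∈ A then Finsupp.single (h.choose : G ⧸ (N ⊓ A)) 1 else 0
  have hl : ∀ n ∈ N, ∀ a ∈ A, l (n * a) = Finsupp.single (n : G ⧸ (N ⊓ A)) 1 := by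
    intro n hn a ha
    have h : ∃ m ∈ N, m⁻¹ * (n * a) ∈ A := ⟨n, hn, by simpa using ha⟩
    simp only [l, dif_pos h]
    congr 1
    refine QuotientGroup.eq.2 ⟨N.mul_mem (N.inv_mem h.choose_spec.1) hn, ?_⟩
    simpa [mul_assoc] using A.mul_mem h.choose_spec.2 (A.inv_mem ha)
  have hl0 : ∀ g, (¬ ∃ n ∈ N, n⁻¹ * g ∈ A) → l g = 0 := fun g h => dif_neg h
  have hdec : ∀ g, (∃ n ∈ N, n⁻¹ * g ∈ A) → ∃ n ∈ N, ∃ a ∈ A, g = n * a := by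
    rintro g ⟨n, hn, ha⟩
    exact ⟨n, hn, _, ha, by group⟩
  refine ⟨l, fun n hn g => ?_, fun g a ha => ?_, by simpa using hl 1 N.one_mem 1 A.one_mem⟩
  · by_cases h : ∃ n ∈ N, n⁻¹ * g ∈ A
    · obtain ⟨m, hm, a, ha, rfl⟩ := hdec g h
      rw [← mul_assoc, hl _ (N.mul_mem hn hm) a ha, hl m hm a ha, permRep_single]
      rfl
    · rw [hl0 g h, hl0, map_zero]
      rintro ⟨m, hm, ha⟩
      exact h ⟨n⁻¹ * m, N.mul_mem (N.inv_mem hn) hm, by simpa [mul_assoc] using ha⟩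
  · by_cases h : ∃ n ∈ N, n⁻¹ * g ∈ A
    · obtain ⟨m, hm, b, hb, rfl⟩ := hdec g h
      rw [mul_assoc, hl m hm _ (A.mul_mem hb ha), hl m hm b hb]
    · rw [hl0 g h, hl0]
      rintro ⟨m, hm, hb⟩
      exact h ⟨m, hm, by simpa [mul_assoc] using A.mul_mem hb (A.inv_mem ha)⟩

end

namespace IsHNNDecomposition

variable {G : Type*} [Group G] {A C D : Subgroup G} {t : G}

/-- The boundary map of the Bass–Serre tree, followed by the projection to the `N`-orbit of the base
vertex. It is `N`-equivariant, and sends the path from the base vertex to its translate by `n ∈ N`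
to the difference of its ends. -/
theorem exists_boundary (hG : IsHNNDecomposition A C D t) (N : Subgroup G) {δ : G → G ⧸ C →₀ ℤ}
    (hδ : IsCrossedHom (permRep G (G ⧸ C)) δ) (hδA : ∀ a ∈ A, δ a = 0)
    (hδt : δ t⁻¹ = Finsupp.single ((1 : G) : G ⧸ C) 1) :
    ∃ d : (G ⧸ C →₀ ℤ) →ₗ[ℤ] (G ⧸ (N ⊓ A) →₀ ℤ),
      (∀ n ∈ N, ∀ f, d (permRep G _ n f) = permRep G _ n (d f)) ∧
      ∀ n ∈ N, d (δ n) = Finsupp.single (n : G ⧸ (N ⊓ A)) 1 -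
        Finsupp.single ((1 : G) : G ⧸ (N ⊓ A)) 1 := by
  obtain ⟨l, hlN, hlA, hl1⟩ := exists_orbit_projection N A
  let b : G ⧸ C → (G ⧸ (N ⊓ A) →₀ ℤ) := fun e => l (e.out * t⁻¹) - l e.out
  have hb : ∀ g : G, b (g : G ⧸ C) = l (g * t⁻¹) - l g := by
    intro g
    obtain ⟨c, hc⟩ := QuotientGroup.mk_out_eq_mul C g
    simp only [b, hc]
    rw [hlA _ _ (hG.1 c.2), show g * c * t⁻¹ = g * t⁻¹ * (t * c * t⁻¹) by group,
      hlA _ _ (hG.conj_mem c.2)]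
  have hd : ∀ g, Finsupp.linearCombination ℤ b (δ g) = l g - l 1 := by
    have hstep : ∀ g, Finsupp.linearCombination ℤ b (δ (g * t⁻¹)) =
        Finsupp.linearCombination ℤ b (δ g) + (l (g * t⁻¹) - l g) := by
      intro g
      rw [hδ, hδt, permRep_single, MulAction.Quotient.smul_coe, smul_eq_mul, mul_one, map_add,
        Finsupp.linearCombination_single, one_smul, hb]
    refine hG.induction_right ?_ ?_ ?_ ?_
    · rw [hδ.map_one, map_zero, sub_self]
    · intro g a ha ih
      rw [hδ, hδA a ha, map_zero, add_zero, ih, hlA g a ha]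
    · intro g ih
      rw [hstep, ih]
      abel
    · intro g ih
      have h1 := hstep (g * t)
      rw [mul_inv_cancel_right, ih] at h1
      rw [eq_sub_of_add_eq h1.symm]
      abel
  refine ⟨Finsupp.linearCombination ℤ b, fun n hn f => ?_, fun n hn => ?_⟩
  · induction f using Finsupp.induction_linear with
    | zero => simp
    | add f g hf hg => simp only [map_add, hf, hg]
    | single e k =>
      induction e using QuotientGroup.induction_on with | H g =>
      rw [permRep_single, Finsupp.linearCombination_single, Finsupp.linearCombination_single,
        MulAction.Quotient.smul_coe, smul_eq_mul, hb, hb, mul_assoc, hlN n hn, hlN n hn, map_smul,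
        map_sub]
  · rw [hd, ← mul_one n, hlN n hn, hl1, permRep_single, MulAction.Quotient.smul_coe, smul_eq_mul]

/-- The boundary map to `ℤ[G ⧸ (N ∩ A)]` lifts to some `ℤ[G ⧸ L]` with `L ≤ N ∩ A` finitely
generated, in such a way that the boundary of the path `δ n` is still `n L - L` for all `n ∈ N`. As
`δ` vanishes on `N ∩ A`, this subgroup is contained in `L`. -/
theorem inf_base_fg (hG : IsHNNDecomposition A C D t) {N : Subgroup G} [N.Normal]
    (hN : N.FG) (h : (N ⊔ C).FiniteIndex) (hNC : (N ⊓ C).FG) : (N ⊓ A).FG := by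
  obtain ⟨δ, hδ, hδA, hδt⟩ := hG.exists_crossedHom_coset (le_refl C)
  obtain ⟨d, hdN, hdδ⟩ := hG.exists_boundary N hδ hδA hδt
  obtain ⟨K, hKM, ψ, hK, hψN, hψ⟩ := exists_equivariant_lift h hNC d hdN
  obtain ⟨S, rfl, hSf⟩ := (Subgroup.fg_iff _).1 hN
  have : Finite S := hSf
  obtain ⟨L, hKL, hLM, hL, hLS⟩ := Subgroup.exists_fg_mapDomain_eq_zero hKM hK
    (fun s : S => ψ (δ s) - (Finsupp.single ((s : G) : G ⧸ K) 1 -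
      Finsupp.single ((1 : G) : G ⧸ K) 1)) (by
      rintro ⟨s, hs⟩
      rw [Finsupp.mapDomain_sub, Finsupp.mapDomain_sub, hψ, hdδ s (Subgroup.subset_closure hs),
        Finsupp.mapDomain_single, Finsupp.mapDomain_single]
      exact sub_self _)
  let p : (G ⧸ K →₀ ℤ) → (G ⧸ L →₀ ℤ) := Finsupp.mapDomain (Subgroup.quotientMapOfLE hKL)
  have hp : ∀ n ∈ Subgroup.closure S, p (ψ (δ n)) =
      Finsupp.single (n : G ⧸ L) 1 - Finsupp.single ((1 : G) : G ⧸ L) 1 := by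
    have hmul : ∀ x ∈ Subgroup.closure S, ∀ y,
        p (ψ (δ (x * y))) = p (ψ (δ x)) + permRep G _ x (p (ψ (δ y))) := by
      intro x hx y
      simp only [p]
      rw [hδ, map_add, hψN x hx, Finsupp.mapDomain_add, mapDomain_quotientMapOfLE_permRep]
    intro n hn
    induction hn using Subgroup.closure_induction with
    | mem s hs =>
      have h1 := hLS ⟨s, hs⟩
      rw [Finsupp.mapDomain_sub, sub_eq_zero, Finsupp.mapDomain_sub, Finsupp.mapDomain_single,
        Finsupp.mapDomain_single] at h1
      exact h1
    | one => simp [p, hδ.map_one]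
    | mul x y hx hy ihx ihy =>
      rw [hmul x hx, ihx, ihy, map_sub, permRep_single, permRep_single,
        MulAction.Quotient.smul_coe, MulAction.Quotient.smul_coe, smul_eq_mul, smul_eq_mul, mul_one]
      abel
    | inv x hx ih =>
      have h1 := hmul x⁻¹ (inv_mem hx) x
      rw [inv_mul_cancel, hδ.map_one, map_zero, ih, map_sub, permRep_single, permRep_single,
        MulAction.Quotient.smul_coe, MulAction.Quotient.smul_coe, smul_eq_mul, smul_eq_mul, mul_one,
        inv_mul_cancel] at h1
      simp only [p, Finsupp.mapDomain_zero] at h1 ⊢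
      rw [eq_neg_of_add_eq_zero_left h1.symm]
      abel
  have hML : Subgroup.closure S ⊓ A ≤ L := by
    intro m hm
    have h1 := hp m hm.1
    simp only [p] at h1
    rw [hδA m hm.2, map_zero, Finsupp.mapDomain_zero, eq_comm, sub_eq_zero,
      Finsupp.single_left_inj one_ne_zero, eq_comm, QuotientGroup.eq] at h1
    simpa using h1
  rwa [le_antisymm hML hLM]

end IsHNNDecomposition

theorem theorem2p2 {G : Type*} [Group G] (A C D : Subgroup G) (t : G)
    (hG : IsHNNDecomposition A C D t) (N : Subgroup G) [N.Normal] :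
    (N.FG → ¬ N ≤ C →
      (N ⊔ C).FiniteIndex ∧ ((N ⊓ C).FG → (N ⊓ A).FG)) ∧
    ((N ⊔ C).FiniteIndex →
      ¬ N ≤ C ∧ ((N ⊓ A).FG → N.FG)) ∧
    ((N ⊔ C).FiniteIndex →
      (Finite (G ⧸ N) ↔ Finite (C ⧸ N.subgroupOf C))) :=
  ⟨fun hN hNC => ⟨hG.finiteIndex_of_fg hN hNC, hG.inf_base_fg hN (hG.finiteIndex_of_fg hN hNC)⟩,
    fun h => ⟨hG.not_le_of_finiteIndex h, hG.fg_of_finiteIndex h⟩,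
    Subgroup.finite_quotient_iff_of_finiteIndex_sup⟩
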